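/- **Definitions.** A finite-state gambler over a finite alphabet $\Sigma$ is a tuple $G=(Q,\Sigma,\delta,\beta,q_0)$ with a finite state set $Q$, start state $q_0\in Q$, transition function $\delta:Q\times\Sigma\to Q\cup\{\bot\}$ ($\bot$ meaning "undefined"), and betting function $\beta$ assigning to each state a rational-valued probability measure on $\Sigma$. Let $\delta(w)$ be the state reached from $q_0$ after reading $w\in\Sigma^*$. For real $s\ge 0$ the $s$-gale of $G$ is the function $d_G^{(s)}:\Sigma^*\to[0,\infty)$ with $d_G^{(s)}(\lambda)=1$ and $d_G^{(s)}(wa)=d_G^{(s)}(w)\cdot\beta(\delta(w))(a)\cdot|\Sigma|^{s}$, where the bet is read as $0$ if $\delta(w)=\bot$. The finite-state dimension of $S\in\Sigma^\infty$, with $S_n$ its prefix of length $n$, is $$\dim_{FS}^{(\Sigma)}(S)=\inf\Bigl\{s\in[0,\infty)\ :\ \text{there is a finite-state gambler } G \text{ over } \Sigma \text{ with } \limsup_{n\to\infty}d_G^{(s)}(S_n)=\infty\Bigr\}.$$ **The sequence $C'$.** Let $d\in(0,1)\cap\mathbb{Q}$ and write $d=d_n/l$ with positive integers $d_n,l$.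 Let $c=1^l$ and let $A\subseteq\{0,1\}^l\setminus\{1^l\}$ with $\log_2|A|=d_n$. For $i\ge 1$ let $\alpha_i\in A^*$ be the concatenation, in lexicographic order, of all strings of length $i$ over the alphabet $A$ (so the characters are the bit strings in $A$), let $\alpha_i^i$ be its $i$-fold repetition, let $\overline{w}$ denote the reverse of $w$, and let $$C'=\alpha_1\,c\,\overline{\alpha_1}\;\,\alpha_2^2\,c\,\overline{\alpha_2^2}\;\,\alpha_3^3\,c\,\overline{\alpha_3^3}\;\cdots .$$ **Lemma.** The finite-state dimension of $C'$, viewed as an infinite binary sequence, is exactly $d$: $$\dim_{FS}^{(\{0,1\})}(C')=d .$$ This holds both when $\overline{w}$ reverses $w\in A^*$ as a string of characters from $A$ (each $l$-bit block being kept intact) and when $\overline{w}$ reverses $w$ as a string of bits. -/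

import Mathlib

open Filter

namespace PDDim

noncomputable section

/-- A rational probability measure on a finite alphabet `α`. -/
structure RatProb (α : Type) [Fintype α] where
  prob : α → ℚ
  nonneg : ∀ a, 0 ≤ prob a
  sum_eq_one : ∑ a, prob a = 1

/-- A finite-state gambler over the alphabet `α`. The value `none` of the transition function
stands for `⊥` (undefined transition). -/
structure FSG (α : Type) [Fintype α] where
  Q : Type
  finQ : Finite Q
  δ : Q → α → Option Q
  β : Q → RatProb α
  q₀ : Q

namespace FSG

variable {α : Type} [Fintype α] (G : FSG α)

/-- One transition; from `⊥` the gambler stays in `⊥`. -/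
def step : Option G.Q → α → Option G.Q
  | none, _ => none
  | some q, a => G.δ q a

/-- The extended transition function `δ*`. -/
def run (q : Option G.Q) (w : List α) : Option G.Q := w.foldl G.step q

/-- The fraction of the capital bet on `a`; after an undefined transition nothing is bet. -/
def bet : Option G.Q → α → ℝ
  | none, _ => 0
  | some q, a => ((G.β q).prob a : ℝ)

/-- The `s`-gale of `G` when started in the state `q`. -/
def galeFrom (s : ℝ) : Option G.Q → List α → ℝ
  | _, [] => 1
  | q, a :: w => G.bet q a * (Fintype.card α : ℝ) ^ s * galeFrom s (G.step q a) w

/-- The `s`-gale of `G`. -/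
def gale (s : ℝ) (w : List α) : ℝ := G.galeFrom s (some G.q₀) w

theorem galeFrom_append_singleton (s : ℝ) (w : List α) (a : α) :
    ∀ q : Option G.Q, G.galeFrom s q (w ++ [a]) =
      G.galeFrom s q w * G.bet (G.run q w) a * (Fintype.card α : ℝ) ^ s := by
  induction w with
  | nil => intro q; simp [galeFrom, run]
  | cons b w ih =>
    intro q
    have h := ih (G.step q b)
    simp only [List.cons_append, galeFrom, h, run, List.foldl_cons]
    ring

/-- The `s`-gale satisfies its defining recursion. -/
theorem gale_nil (s : ℝ) : G.gale s [] = 1 := rfl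

theorem gale_append_singleton (s : ℝ) (w : List α) (a : α) :
    G.gale s (w ++ [a]) =
      G.gale s w * G.bet (G.run (some G.q₀) w) a * (Fintype.card α : ℝ) ^ s :=
  G.galeFrom_append_singleton s w a (some G.q₀)

end FSG

/-- The prefix of length `n` of an infinite sequence. -/
def seqPrefix {α : Type} (S : ℕ → α) (n : ℕ) : List α := (List.range n).map S

/-- `G` `s`-succeeds on `S`: the limsup of its `s`-gale along the prefixes of `S` is `∞`. -/
def FSG.Succeeds {α : Type} [Fintype α] (G : FSG α) (s : ℝ) (S : ℕ → α) : Prop :=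
  limsup (fun n : ℕ => ((G.gale s (seqPrefix S n) : ℝ) : EReal)) atTop = ⊤

/-- The finite-state dimension of a sequence over the alphabet `α`, an infimum in the extended
reals. -/
def dimFS {α : Type} [Fintype α] (S : ℕ → α) : EReal :=
  sInf ((fun s : ℝ => (s : EReal)) '' {s : ℝ | 0 ≤ s ∧ ∃ G : FSG α, G.Succeeds s S})

/-- The concatenation `b 0 ++ b 1 ++ ⋯ ++ b (m - 1)`. -/
def concatFirst {α : Type} (b : ℕ → List α) (m : ℕ) : List α := (List.range m).flatMap b

/-- The infinite concatenation `b 0 ++ b 1 ++ b 2 ++ ⋯` of nonempty strings: its `n`-th character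
(counted from `0`) already occurs in the concatenation of the first `n + 1` strings. -/
def infConcat {α : Type} [Inhabited α] (b : ℕ → List α) (n : ℕ) : α :=
  (concatFirst b (n + 1)).getD n default

theorem concatFirst_succ {α : Type} (b : ℕ → List α) (m : ℕ) :
    concatFirst b (m + 1) = concatFirst b m ++ b m := by
  simp [concatFirst, List.range_succ]

theorem concatFirst_prefix {α : Type} (b : ℕ → List α) {m k : ℕ} (h : m ≤ k) :
    concatFirst b m <+: concatFirst b k := by
  induction k, h using Nat.le_induction with
  | base => exact List.prefix_refl _
  | succ k _ ih => exact ih.trans (by rw [concatFirst_succ]; exact List.prefix_append _ _)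

theorem le_length_concatFirst {α : Type} (b : ℕ → List α) (hb : ∀ n, b n ≠ []) (m : ℕ) :
    m ≤ (concatFirst b m).length := by
  induction m with
  | zero => simp
  | succ m ih =>
    have := List.length_pos_iff.mpr (hb m)
    rw [concatFirst_succ, List.length_append]
    omega

/-- Every finite concatenation is a prefix of the infinite one. -/
theorem seqPrefix_infConcat {α : Type} [Inhabited α] (b : ℕ → List α) (hb : ∀ n, b n ≠ [])
    (m : ℕ) : seqPrefix (infConcat b) (concatFirst b m).length = concatFirst b m := by
  apply List.ext_getElem
  · simp [seqPrefix]
  · intro i h1 h2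
    have h3 : i < (concatFirst b (i + 1)).length :=
      lt_of_lt_of_le (Nat.lt_succ_self i) (le_length_concatFirst b hb (i + 1))
    simp only [seqPrefix, List.getElem_map, List.getElem_range, infConcat]
    rw [List.getD_eq_getElem _ _ h3]
    rcases le_total m (i + 1) with h | h
    · exact ((concatFirst_prefix b h).getElem h2).symm
    · exact (concatFirst_prefix b h).getElem h3

/-- The finite set of all strings of length `i` over the alphabet `A`. A character is a bit
string, so a string over `A` is a list of bit strings. -/
def wordsOver (A : Finset (List Bool)) (i : ℕ) : Finset (List (List Bool)) :=
  (Fintype.piFinset fun _ : Fin i => A).image List.ofFn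

theorem mem_wordsOver (A : Finset (List Bool)) (i : ℕ) (w : List (List Bool)) :
    w ∈ wordsOver A i ↔ w.length = i ∧ ∀ a ∈ w, a ∈ A := by
  simp only [wordsOver, Finset.mem_image, Fintype.mem_piFinset]
  constructor
  · rintro ⟨f, hf, rfl⟩
    refine ⟨by simp, fun a ha => ?_⟩
    obtain ⟨j, rfl⟩ := (List.mem_ofFn' f a).mp ha
    exact hf j
  · rintro ⟨rfl, h⟩
    exact ⟨w.get, fun j => h _ (List.get_mem w j), List.ofFn_get w⟩

/-- `α_i`: all strings of length `i` over `A`, concatenated in lexicographic order. -/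
def alphaStr (A : Finset (List Bool)) (i : ℕ) : List (List Bool) :=
  ((wordsOver A i).sort (· ≤ ·)).flatten

/-- `α_i` repeated `i` times, a string over `A`. -/
def alphaPow (A : Finset (List Bool)) (i : ℕ) : List (List Bool) :=
  (List.replicate i (alphaStr A i)).flatten

/-- The marker `c = 1^l`. -/
def marker (l : ℕ) : List Bool := List.replicate l true

/-- The binary sequence `C' = α_1 c rev(α_1) α_2 α_2 c rev(α_2 α_2) ⋯`, where `rev` reverses a
string over `A` as a string of characters from `A`. -/
def champMarked (l : ℕ) (A : Finset (List Bool)) : ℕ → Bool :=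
  infConcat fun k =>
    (alphaPow A (k + 1) ++ [marker l] ++ (alphaPow A (k + 1)).reverse).flatten

/-- The binary sequence `C'` as above, where `rev` reverses a string over `A` as a bit string. -/
def champMarkedBitRev (l : ℕ) (A : Finset (List Bool)) : ℕ → Bool :=
  infConcat fun k =>
    (alphaPow A (k + 1)).flatten ++ marker l ++ (alphaPow A (k + 1)).flatten.reverse

end

end PDDim

/-! ### Gale bounds on lists of distinct words -/

namespace PDDim

namespace FSG

variable {α : Type} [Fintype α] (G : FSG α)

/-! Put `N = |A| = 2 ^ dn` and `R = 2 ^ (s * l)`, so that `s < d` means `R < N` and `s > d` means `R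
> N`.

For `s < d`, fix a gambler with `K` states, counting `⊥`. From each state the gale values over
distinct words of `i * l` bits sum to at most `R ^ i`, so summed over all starting states as well
they give at most `K * R ^ i`. Since `x ≤ exp (x - 1)`, reading all `N ^ i` words of `α_i` in a row
multiplies the capital by at most `exp (K * R ^ i - N ^ i)` (`FSG.galeFrom_flatten_le`). The order
of the words is irrelevant, so the reversals obey the same bound. For large `i` the loss on block
`i` exceeds any gain possible on a prefix of block `i + 1`, and the gale stays bounded
(`not_succeeds_of_listings`).

For `s > d`, a gambler reading `l` bits at a time bets almost uniformly on `A` and reserves a small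
weight `η` for every other word. Each expected word gains a factor above `1`. Under bit reversal the
expected words change from `A` to the reversed words, so the gambler keeps a mode and toggles it
after an unexpected word. A block costs at most three factors `η`, while the number of gains grows
with the block (`exists_succeeds_of_blocks`). -/

theorem bet_nonneg (q : Option G.Q) (a : α) : 0 ≤ G.bet q a := by
  cases q with
  | none => exact le_rfl
  | some q => exact Rat.cast_nonneg.mpr ((G.β q).nonneg a)

theorem sum_bet_le_one (q : Option G.Q) : ∑ a, G.bet q a ≤ 1 := by
  cases q with
  | none => simp [bet]
  | some q => exact le_of_eq (by simpa [bet] using congrArg (fun x : ℚ => (x : ℝ)) (G.β q).sum_eq_one)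

theorem bet_le_one (q : Option G.Q) (a : α) : G.bet q a ≤ 1 :=
  (Finset.single_le_sum (fun b _ => G.bet_nonneg q b) (Finset.mem_univ a)).trans
    (G.sum_bet_le_one q)

theorem card_rpow_nonneg (α : Type) [Fintype α] (s : ℝ) : 0 ≤ (Fintype.card α : ℝ) ^ s :=
  Real.rpow_nonneg (Nat.cast_nonneg _) s

theorem galeFrom_nonneg (s : ℝ) (w : List α) : ∀ q, 0 ≤ G.galeFrom s q w := by
  induction w with
  | nil => intro q; exact zero_le_one
  | cons a w ih =>
    intro q
    exact mul_nonneg (mul_nonneg (G.bet_nonneg q a) (card_rpow_nonneg α s)) (ih _)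

theorem galeFrom_append (s : ℝ) (u v : List α) :
    ∀ q, G.galeFrom s q (u ++ v) = G.galeFrom s q u * G.galeFrom s (G.run q u) v := by
  induction u with
  | nil => intro q; simp [galeFrom, run]
  | cons a u ih =>
    intro q
    simp only [List.cons_append, galeFrom, ih, run, List.foldl_cons]
    ring

theorem galeFrom_append_le {s C D : ℝ} {u v : List α} (hC : 0 ≤ C)
    (hu : ∀ q, G.galeFrom s q u ≤ C) (hv : ∀ q, G.galeFrom s q v ≤ D) (q : Option G.Q) :
    G.galeFrom s q (u ++ v) ≤ C * D := by
  rw [galeFrom_append]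
  exact mul_le_mul (hu q) (hv _) (G.galeFrom_nonneg s _ _) hC

theorem galeFrom_le_pow (s : ℝ) (w : List α) :
    ∀ q, G.galeFrom s q w ≤ ((Fintype.card α : ℝ) ^ s) ^ w.length := by
  induction w with
  | nil => intro q; simp [galeFrom]
  | cons a w ih =>
    intro q
    have hb := card_rpow_nonneg α s
    rw [galeFrom, List.length_cons, pow_succ']
    refine mul_le_mul ?_ (ih _) (G.galeFrom_nonneg s _ _) hb
    exact mul_le_of_le_one_left hb (G.bet_le_one q a)

/-- The values of an `s`-gale on distinct words of length `L` sum to at most `|α| ^ (s * L)`. -/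
theorem sum_galeFrom_le (s : ℝ) (L : ℕ) : ∀ (W : Finset (List α)), (∀ w ∈ W, w.length = L) →
    ∀ q, ∑ w ∈ W, G.galeFrom s q w ≤ ((Fintype.card α : ℝ) ^ s) ^ L := by
  classical
  induction L with
  | zero =>
    intro W hW q
    have hsub : W ⊆ {[]} := fun w hw => by simpa using hW w hw
    refine (Finset.sum_le_sum_of_subset_of_nonneg hsub
      fun w _ _ => G.galeFrom_nonneg s w q).trans ?_
    simp [galeFrom]
  | succ L ih =>
    intro W hW q
    have hb := card_rpow_nonneg α s
    set V : Finset (List α) := W.image List.tail with hV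
    have hVl : ∀ v ∈ V, v.length = L := by
      intro v hv
      obtain ⟨w, hw, rfl⟩ := Finset.mem_image.mp hv
      simp [hW w hw]
    -- Enlarging `W` to all first letters times all tails makes the sum factor; nonnegativity of the
    -- gale makes this harmless.
    have hsub : W ⊆ ((Finset.univ : Finset α) ×ˢ V).image fun p => p.1 :: p.2 := by
      intro w hw
      cases w with
      | nil => simpa using hW [] hw
      | cons a w =>
        exact Finset.mem_image.mpr ⟨(a, w), Finset.mem_product.mpr
          ⟨Finset.mem_univ a, Finset.mem_image.mpr ⟨a :: w, hw, rfl⟩⟩, rfl⟩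
    refine (Finset.sum_le_sum_of_subset_of_nonneg hsub
      fun w _ _ => G.galeFrom_nonneg s w q).trans ?_
    rw [Finset.sum_image (fun p _ p' _ h => by
      obtain ⟨h1, h2⟩ := List.cons.inj h
      exact Prod.ext h1 h2), Finset.sum_product]
    calc ∑ a, ∑ w ∈ V, G.galeFrom s q (a :: w)
        = ∑ a, G.bet q a * (Fintype.card α : ℝ) ^ s * ∑ w ∈ V, G.galeFrom s (G.step q a) w := by
          simp only [galeFrom, Finset.mul_sum]
      _ ≤ ∑ a, G.bet q a * ((Fintype.card α : ℝ) ^ s) ^ (L + 1) := by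
          refine Finset.sum_le_sum fun a _ => ?_
          rw [pow_succ', ← mul_assoc]
          exact mul_le_mul_of_nonneg_left (ih V hVl _) (mul_nonneg (G.bet_nonneg q a) hb)
      _ ≤ ((Fintype.card α : ℝ) ^ s) ^ (L + 1) := by
          rw [← Finset.sum_mul]
          exact mul_le_of_le_one_left (pow_nonneg hb _) (G.sum_bet_le_one q)

/-- On a concatenation of `m` distinct words of length `L` an `s`-gale grows at most by the factor
`exp (K * |α| ^ (s * L) - m)`, where `K` is the number of states, including `⊥`. -/
theorem galeFrom_flatten_le [Fintype G.Q] (s : ℝ) (L : ℕ) (ws : List (List α)) (hnd : ws.Nodup)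
    (hL : ∀ w ∈ ws, w.length = L) (q : Option G.Q) :
    G.galeFrom s q ws.flatten ≤
      Real.exp (Fintype.card (Option G.Q) * ((Fintype.card α : ℝ) ^ s) ^ L - ws.length) := by
  classical
  -- The state in which a word is entered depends on the earlier words. Summing over all states
  -- removes this dependence at the price of the factor `K`.
  set h : List α → ℝ := fun w => ∑ q, G.galeFrom s q w with hh
  have hle : ∀ q w, G.galeFrom s q w ≤ h w := fun q w =>
    Finset.single_le_sum (f := fun q => G.galeFrom s q w)
      (fun b _ => G.galeFrom_nonneg s w b) (Finset.mem_univ q)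
  have key : ∀ (vs : List (List α)) (q : Option G.Q), G.galeFrom s q vs.flatten ≤
      Real.exp ((vs.map h).sum - vs.length) := by
    intro vs
    induction vs with
    | nil => intro q; simp [galeFrom]
    | cons w vs ih =>
      intro q
      rw [List.flatten_cons, galeFrom_append, List.map_cons, List.sum_cons, List.length_cons,
        Nat.cast_add, Nat.cast_one,
        show h w + (vs.map h).sum - ((vs.length : ℝ) + 1)
          = (h w - 1) + ((vs.map h).sum - vs.length) by ring, Real.exp_add]
      refine mul_le_mul ((hle q w).trans ?_) (ih _) (G.galeFrom_nonneg s _ _) (Real.exp_nonneg _)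
      linarith [Real.add_one_le_exp (h w - 1)]
  refine (key ws q).trans (Real.exp_le_exp.mpr (sub_le_sub_right ?_ _))
  rw [← List.sum_toFinset h hnd, hh, Finset.sum_comm]
  refine (Finset.sum_le_sum fun q _ =>
    G.sum_galeFrom_le s L ws.toFinset (fun w hw => hL w (List.mem_toFinset.mp hw)) q).trans ?_
  simp

end FSG

theorem prefix_append_cases {α : Type} {p u v : List α} (h : p <+: u ++ v) :
    p <+: u ∨ ∃ r, p = u ++ r ∧ r <+: v := by
  rcases List.prefix_or_prefix_of_prefix h (List.prefix_append u v) with h1 | ⟨r, rfl⟩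
  · exact Or.inl h1
  · exact Or.inr ⟨r, rfl, (List.prefix_append_right_inj u).mp h⟩

/-- A prefix of a concatenation consists of complete words followed by a prefix of a word. -/
theorem prefix_flatten {α : Type} (ws : List (List α)) : ∀ p, p <+: ws.flatten →
    ∃ vs t, vs <+: ws ∧ p = vs.flatten ++ t ∧ (t = [] ∨ ∃ w ∈ ws, t <+: w) := by
  induction ws with
  | nil => intro p hp; exact ⟨[], [], List.prefix_rfl, by simpa using hp, Or.inl rfl⟩
  | cons w ws ih =>
    intro p hp
    rw [List.flatten_cons] at hp
    rcases prefix_append_cases hp with h | ⟨r, rfl, hr⟩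
    · exact ⟨[], p, List.nil_prefix, rfl, Or.inr ⟨w, by simp, h⟩⟩
    · obtain ⟨vs, t, h1, rfl, h3⟩ := ih r hr
      refine ⟨w :: vs, t, by simpa using h1, by simp, h3.imp_right ?_⟩
      rintro ⟨v, hv, hvt⟩
      exact ⟨v, by simp [hv], hvt⟩

/-- A string that lists `m` distinct words of length `L`. -/
def IsListing {α : Type} (m L : ℕ) (u : List α) : Prop :=
  ∃ ws : List (List α), ws.Nodup ∧ ws.length = m ∧ (∀ w ∈ ws, w.length = L) ∧ u = ws.flatten

namespace FSG

variable {α : Type} [Fintype α] (G : FSG α)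

theorem galeFrom_listing_le [Fintype G.Q] (s : ℝ) {m L : ℕ} {u : List α} (hu : IsListing m L u)
    (q : Option G.Q) : G.galeFrom s q u ≤
      Real.exp (Fintype.card (Option G.Q) * ((Fintype.card α : ℝ) ^ s) ^ L - m) := by
  obtain ⟨ws, hnd, rfl, hL, rfl⟩ := hu
  exact G.galeFrom_flatten_le s L ws hnd hL q

/-- The complete words in the prefix are still distinct, so the listing bound applies with its
negative term dropped; the cut word gets the trivial bound. -/
theorem galeFrom_prefix_listing_le [Fintype G.Q] {s : ℝ} (hs : 1 ≤ (Fintype.card α : ℝ) ^ s)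
    {m L : ℕ} {u : List α} (hu : IsListing m L u) {p : List α} (hp : p <+: u) (q : Option G.Q) :
    G.galeFrom s q p ≤ Real.exp (Fintype.card (Option G.Q) * ((Fintype.card α : ℝ) ^ s) ^ L) *
      ((Fintype.card α : ℝ) ^ s) ^ L := by
  obtain ⟨ws, hnd, rfl, hL, rfl⟩ := hu
  obtain ⟨vs, t, hvs, rfl, ht⟩ := prefix_flatten ws p hp
  have htL : t.length ≤ L := by
    rcases ht with rfl | ⟨w, hw, htw⟩
    · simp
    · exact htw.length_le.trans_eq (hL w hw)
  refine G.galeFrom_append_le (Real.exp_nonneg _) (fun q => ?_) (fun q => ?_) q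
  · refine (G.galeFrom_flatten_le s L vs (hnd.sublist hvs.sublist)
      (fun w hw => hL w (hvs.subset hw)) q).trans (Real.exp_le_exp.mpr ?_)
    linarith [Nat.cast_nonneg (α := ℝ) vs.length]
  · exact (G.galeFrom_le_pow s t q).trans (pow_le_pow_right₀ hs htL)

theorem galeFrom_replicate_le {s C : ℝ} (hC : 0 ≤ C) {u : List α}
    (hu : ∀ q, G.galeFrom s q u ≤ C) (i : ℕ) :
    ∀ q, G.galeFrom s q (List.replicate i u).flatten ≤ C ^ i := by
  induction i with
  | zero => intro q; simp [galeFrom]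
  | succ i ih =>
    intro q
    rw [List.replicate_succ, List.flatten_cons, pow_succ']
    exact G.galeFrom_append_le hC hu ih q

theorem galeFrom_prefix_append_le {s C D E : ℝ} {u v : List α} (hC : 0 ≤ C)
    (hu : ∀ q, G.galeFrom s q u ≤ C) (hpu : ∀ p, p <+: u → ∀ q, G.galeFrom s q p ≤ E)
    (hpv : ∀ p, p <+: v → ∀ q, G.galeFrom s q p ≤ D) (hE : C * D ≤ E) :
    ∀ p, p <+: u ++ v → ∀ q, G.galeFrom s q p ≤ E := by
  intro p hp q
  rcases prefix_append_cases hp with h | ⟨r, rfl, hr⟩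
  · exact hpu p h q
  · exact (G.galeFrom_append_le hC hu (hpv r hr) q).trans hE

/-- Completed copies never increase the capital, so only the copy that is cut matters and the bound
does not depend on `i`. -/
theorem galeFrom_prefix_replicate_le {s D : ℝ} {u : List α} (hu : ∀ q, G.galeFrom s q u ≤ 1)
    (hD : 1 ≤ D) (hp : ∀ p, p <+: u → ∀ q, G.galeFrom s q p ≤ D) (i : ℕ) :
    ∀ p, p <+: (List.replicate i u).flatten → ∀ q, G.galeFrom s q p ≤ D := by
  induction i with
  | zero =>
    intro p hp q
    have : p = [] := by simpa using hp
    simpa [this, galeFrom] using hD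
  | succ i ih =>
    rw [List.replicate_succ, List.flatten_cons]
    exact G.galeFrom_prefix_append_le zero_le_one hu hp ih (one_mul D).le

end FSG

/-! ### Lower bound on the dimension -/

/-- The prefix of length `n` of an infinite concatenation is made of whole blocks followed by a
prefix of the next block; the number of whole blocks tends to infinity with `n`. -/
theorem seqPrefix_infConcat_eq {α : Type} [Inhabited α] (b : ℕ → List α) (hb : ∀ n, b n ≠ [])
    (m n : ℕ) (hn : (concatFirst b m).length ≤ n) :
    ∃ k, m ≤ k ∧ ∃ p, p <+: b k ∧ seqPrefix (infConcat b) n = concatFirst b k ++ p := by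
  classical
  have hex : ∃ k, n < (concatFirst b k).length :=
    ⟨n + 1, (Nat.lt_succ_self n).trans_le (le_length_concatFirst b hb (n + 1))⟩
  set K := Nat.find hex with hK
  have hKn : n < (concatFirst b K).length := Nat.find_spec hex
  have hmK : m < K := by
    by_contra hcon
    exact absurd ((concatFirst_prefix b (not_lt.mp hcon)).length_le) (by omega)
  obtain ⟨k, hk⟩ : ∃ k, K = k + 1 := ⟨K - 1, by omega⟩
  have hkn : (concatFirst b k).length ≤ n := by
    by_contra hcon
    exact Nat.find_min hex (show k < K by omega) (not_le.mp hcon)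
  have hpre : seqPrefix (infConcat b) n = (concatFirst b (k + 1)).take n := by
    rw [← hk, ← seqPrefix_infConcat b hb K, seqPrefix, seqPrefix, ← List.map_take,
      List.take_range, min_eq_left hKn.le]
  refine ⟨k, by omega, (b k).take (n - (concatFirst b k).length), List.take_prefix _ _, ?_⟩
  rw [hpre, concatFirst_succ, List.take_append, List.take_of_length_le hkn]

theorem eventually_mul_pow_le (K r : ℝ) {R N : ℝ} (hR : 0 ≤ R) (hRN : R < N) (hN : 1 < N) :
    ∀ᶠ i : ℕ in atTop, K * R ^ i ≤ N ^ i ∧ ((i : ℝ) + 3) * r ≤ N ^ i := by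
  have hN0 : 0 < N := by linarith
  have h1 : Tendsto (fun i : ℕ => K * (R / N) ^ i) atTop (nhds 0) := by
    simpa using (tendsto_pow_atTop_nhds_zero_of_lt_one (div_nonneg hR hN0.le)
      ((div_lt_one hN0).mpr hRN)).const_mul K
  have h2 : Tendsto (fun i : ℕ => ((i : ℝ) ^ 1 / N ^ i) * r + (3 * r) * (N⁻¹) ^ i) atTop
      (nhds 0) := by
    simpa using ((tendsto_pow_const_div_const_pow_of_one_lt 1 hN).mul_const r).add
      ((tendsto_pow_atTop_nhds_zero_of_lt_one (inv_nonneg.mpr hN0.le)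
        (inv_lt_one_of_one_lt₀ hN)).const_mul (3 * r))
  filter_upwards [h1.eventually_le_const one_pos, h2.eventually_le_const one_pos] with i h3 h4
  have hp : 0 < N ^ i := pow_pos hN0 i
  constructor
  · rw [div_pow, ← mul_div_assoc, div_le_one hp] at h3
    exact h3
  · rw [inv_pow, pow_one, ← div_eq_mul_inv, div_mul_eq_mul_div, ← add_div, div_le_one hp] at h4
    linarith

/-- No finite-state gambler `s`-succeeds on a concatenation of blocks `u ^ i c v ^ i`, where `u` and
`v` list `N ^ i` distinct words of length `i * l`, if `|α| ^ (s * l) < N`. -/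
theorem not_succeeds_of_listings {α : Type} [Fintype α] [Inhabited α] (G : FSG α) {s : ℝ}
    (hs : 0 ≤ s) {l N : ℕ} (hN : 1 < N) (hl : 0 < l)
    (hsN : ((Fintype.card α : ℝ) ^ s) ^ l < N) (b : ℕ → List α) (c : List α) (hc : c.length = l)
    (hb : ∀ k, ∃ u v, IsListing (N ^ (k + 1)) ((k + 1) * l) u ∧
      IsListing (N ^ (k + 1)) ((k + 1) * l) v ∧
      b k = (List.replicate (k + 1) u).flatten ++ c ++ (List.replicate (k + 1) v).flatten) :
    ¬ G.Succeeds s (infConcat b) := by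
  classical
  have := G.finQ
  let _ := Fintype.ofFinite G.Q
  have hB : 1 ≤ (Fintype.card α : ℝ) ^ s :=
    Real.one_le_rpow (by exact_mod_cast Fintype.card_pos (α := α)) hs
  set B : ℝ := (Fintype.card α : ℝ) ^ s with hBdef
  set R : ℝ := B ^ l with hRdef
  set K : ℝ := (Fintype.card (Option G.Q) : ℝ) with hKdef
  have hK0 : 0 ≤ K := Nat.cast_nonneg _
  have hR1 : 1 ≤ R := one_le_pow₀ hB
  have hR0 : 0 < R := by linarith
  have hBR : ∀ i : ℕ, B ^ (i * l) = R ^ i := fun i => by rw [hRdef, ← pow_mul, mul_comm]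
  have hbne : ∀ k, b k ≠ [] := by
    intro k hk
    obtain ⟨u, v, -, -, h⟩ := hb k
    rw [hk] at h
    have := congrArg List.length h
    simp only [List.length_append, List.length_nil] at this
    omega
  -- For block `i` followed by part of block `i + 1`: `2 * K` comes from the two halves of block
  -- `i`, and `K * R` from the cut listing, as `K * R ^ (i + 1) = K * R * R ^ i`. The `i + 3`
  -- factors `R` are two markers and the `R ^ (i + 1)` of the cut word.
  obtain ⟨i₀, hi₀⟩ := eventually_atTop.mp
    (eventually_mul_pow_le (2 * K + K * R) (Real.log R) hR0.le hsN (by exact_mod_cast hN))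
  set x : ℕ → ℝ := fun i => Real.exp (K * R ^ i - N ^ i) with hx
  set D : ℕ → ℝ := fun i => R * (Real.exp (K * R ^ i) * R ^ i) with hD
  have hD1 : ∀ i, 1 ≤ Real.exp (K * R ^ i) * R ^ i := fun i =>
    one_le_mul_of_one_le_of_one_le (Real.one_le_exp (by positivity)) (one_le_pow₀ hR1)
  have hxle : ∀ i, i₀ ≤ i → K * R ^ i - N ^ i ≤ 0 := fun i hi => by
    have h := (hi₀ i hi).1
    have h2 : 0 ≤ K * R ^ i := by positivity
    have h3 : 0 ≤ K * R ^ i * R := by positivity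
    nlinarith
  have hblock : ∀ k, i₀ ≤ k → ∀ q, G.galeFrom s q (b k) ≤ x (k + 1) ^ 2 * R := by
    intro k hk q
    obtain ⟨u, v, hu, hv, hbk⟩ := hb k
    have hx1 : x (k + 1) ≤ 1 := Real.exp_le_one_iff.mpr (hxle (k + 1) (by omega))
    have hx0 : 0 ≤ x (k + 1) := Real.exp_nonneg _
    have hw : ∀ w, IsListing (N ^ (k + 1)) ((k + 1) * l) w → ∀ q,
        G.galeFrom s q (List.replicate (k + 1) w).flatten ≤ x (k + 1) := by
      intro w hw q
      -- The loss on one copy already suffices; the others are bounded by `1`.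
      refine (G.galeFrom_replicate_le hx0 (fun q => ?_) (k + 1) q).trans
        (pow_le_of_le_one hx0 hx1 (by omega))
      have h := G.galeFrom_listing_le s hw q
      rwa [← hBdef, ← hKdef, hBR, Nat.cast_pow] at h
    rw [hbk, show x (k + 1) ^ 2 * R = x (k + 1) * R * x (k + 1) by ring]
    refine G.galeFrom_append_le (by positivity)
      (G.galeFrom_append_le hx0 (hw u hu) fun q => ?_) (hw v hv) q
    exact (G.galeFrom_le_pow s c q).trans_eq (by rw [hc])
  have hprefix : ∀ k, i₀ ≤ k → ∀ p, p <+: b k → ∀ q, G.galeFrom s q p ≤ D (k + 1) := by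
    intro k hk
    obtain ⟨u, v, hu, hv, hbk⟩ := hb k
    have hx1 : x (k + 1) ≤ 1 := Real.exp_le_one_iff.mpr (hxle (k + 1) (by omega))
    have hfull : ∀ w, IsListing (N ^ (k + 1)) ((k + 1) * l) w → ∀ q, G.galeFrom s q w ≤ 1 := by
      intro w hw q
      refine le_trans ?_ hx1
      have h := G.galeFrom_listing_le s hw q
      rwa [← hBdef, ← hKdef, hBR, Nat.cast_pow] at h
    have hw : ∀ w, IsListing (N ^ (k + 1)) ((k + 1) * l) w → ∀ p,
        p <+: (List.replicate (k + 1) w).flatten → ∀ q, G.galeFrom s q p ≤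
          Real.exp (K * R ^ (k + 1)) * R ^ (k + 1) := by
      intro w hw
      refine G.galeFrom_prefix_replicate_le (hfull w hw) (hD1 _) (fun p hp q => ?_) _
      have h := G.galeFrom_prefix_listing_le hB hw hp q
      rwa [← hBdef, ← hKdef, hBR] at h
    have hDD : Real.exp (K * R ^ (k + 1)) * R ^ (k + 1) ≤ D (k + 1) :=
      le_mul_of_one_le_left (by positivity) hR1
    rw [hbk, List.append_assoc]
    refine G.galeFrom_prefix_append_le zero_le_one (fun q => ?_)
      (fun p hp q => (hw u hu p hp q).trans hDD) (D := D (k + 1)) ?_ (one_mul _).le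
    · refine (G.galeFrom_replicate_le zero_le_one (hfull u hu) (k + 1) q).trans_eq (one_pow _)
    · refine G.galeFrom_prefix_append_le hR0.le (fun q => ?_) (fun p hp q => ?_) (hw v hv) le_rfl
      · exact (G.galeFrom_le_pow s c q).trans_eq (by rw [hc])
      · refine (G.galeFrom_le_pow s p q).trans ?_
        refine (pow_le_pow_right₀ hB (hp.length_le.trans_eq hc)).trans ?_
        exact le_mul_of_one_le_right hR0.le (hD1 _)
  -- The loss on a finished block pays in advance for any gain inside the next one.
  have hcomb : ∀ k, i₀ ≤ k → x (k + 1) ^ 2 * R * D (k + 2) ≤ 1 := by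
    intro k hk
    obtain ⟨h1, h2⟩ := hi₀ (k + 1) (by omega)
    have hlog : ∀ j : ℕ, R ^ j = Real.exp (j * Real.log R) := fun j => by
      rw [Real.exp_nat_mul, Real.exp_log hR0]
    have : x (k + 1) ^ 2 * R * D (k + 2) = Real.exp (2 * (K * R ^ (k + 1) - N ^ (k + 1))
        + K * R ^ (k + 2) + ((k + 4 : ℕ) : ℝ) * Real.log R) := by
      rw [two_mul, Real.exp_add, Real.exp_add, Real.exp_add, ← hlog]
      simp only [hx, hD]
      ring
    rw [this, Real.exp_le_one_iff]
    push_cast at h2 ⊢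
    have h3 : K * R ^ (k + 2) = K * R * R ^ (k + 1) := by ring
    have h4 : (k + 4 : ℝ) * Real.log R = ((k : ℝ) + 1 + 3) * Real.log R := by ring
    rw [h3, h4]
    linarith
  have hD1' : ∀ i, 1 ≤ D i := fun i => one_le_mul_of_one_le_of_one_le hR1 (hD1 i)
  have hblock1 : ∀ k, i₀ ≤ k → x (k + 1) ^ 2 * R ≤ 1 := fun k hk =>
    (le_mul_of_one_le_right (by positivity) (hD1' _)).trans (hcomb k hk)
  set C : ℝ := G.gale s (concatFirst b i₀) with hCdef
  have hC0 : 0 ≤ C := G.galeFrom_nonneg s _ _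
  have hconcat : ∀ k, i₀ ≤ k → G.gale s (concatFirst b k) ≤ C := by
    intro k hk
    induction k, hk using Nat.le_induction with
    | base => exact le_rfl
    | succ k hk ih =>
      rw [concatFirst_succ, FSG.gale, FSG.galeFrom_append]
      refine (mul_le_of_le_one_right (G.galeFrom_nonneg s _ _) ?_).trans ih
      exact (hblock k hk _).trans (hblock1 k hk)
  have hbound : ∀ᶠ n : ℕ in atTop, ((G.gale s (seqPrefix (infConcat b) n) : ℝ) : EReal) ≤ C := by
    -- Starting at `i₀ + 1` ensures that the cut block is preceded by a full block of index at least
    -- `i₀`.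
    filter_upwards [eventually_ge_atTop (concatFirst b (i₀ + 1)).length] with n hn
    obtain ⟨k, hk, p, hp, heq⟩ := seqPrefix_infConcat_eq b hbne (i₀ + 1) n hn
    obtain ⟨j, rfl⟩ : ∃ j, k = j + 1 := ⟨k - 1, by omega⟩
    have hj : i₀ ≤ j := by omega
    rw [EReal.coe_le_coe_iff, heq, concatFirst_succ, List.append_assoc, FSG.gale,
      FSG.galeFrom_append]
    refine (mul_le_of_le_one_right (G.galeFrom_nonneg s _ _) ?_).trans (hconcat j hj)
    exact (G.galeFrom_append_le (by positivity) (hblock j hj)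
      (hprefix (j + 1) (by omega) p hp) _).trans (hcomb j hj)
  intro hsucc
  have h := limsup_le_of_le (by isBoundedDefault) hbound
  rw [FSG.Succeeds] at hsucc
  rw [hsucc] at h
  exact EReal.coe_ne_top C (top_le_iff.mp h)

end PDDim

/-! ### Upper bound on the dimension: a gambler with two modes -/

namespace PDDim

namespace ToggleGambler

variable (l : ℕ) (X : Bool → Finset (List Bool)) (η : ℚ)

/-- The weight of the word `w` in the mode `M`: words outside `X M` are given the weight `η`. -/
def weight (M : Bool) (w : List Bool) : ℚ := if w ∈ X M then 1 else η

/-- The total weight of the extensions of `p` by `n` letters. -/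
def totalWeight (M : Bool) : ℕ → List Bool → ℚ
  | 0, p => weight X η M p
  | n + 1, p => totalWeight M n (p ++ [false]) + totalWeight M n (p ++ [true])

/-- The mode is toggled by a word outside `X M`. -/
def nextMode (M : Bool) (w : List Bool) : Bool := if w ∈ X M then M else !M

variable {η}

theorem weight_pos (hη : 0 < η) (M : Bool) (w : List Bool) : 0 < weight X η M w := by
  unfold weight; split_ifs <;> simp [hη]

theorem le_weight (hη : η ≤ 1) (M : Bool) (w : List Bool) : η ≤ weight X η M w := by
  unfold weight; split_ifs <;> simp [hη]

theorem totalWeight_pos (hη : 0 < η) (M : Bool) (n : ℕ) :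
    ∀ p, 0 < totalWeight X η M n p := by
  induction n with
  | zero => exact weight_pos X hη M
  | succ n ih => exact fun p => add_pos (ih _) (ih _)

/-- Words of `X M` extending `p` by `false` and by `true` form disjoint families, while the `η` term
doubles with each letter. -/
theorem totalWeight_le (hη : 0 < η) (M : Bool) (n : ℕ) : ∀ p,
    totalWeight X η M n p ≤ ((X M).filter fun w => p <+: w).card + η * 2 ^ n := by
  induction n with
  | zero =>
    intro p
    simp only [totalWeight, weight, pow_zero, mul_one]
    split_ifs with h
    · have : 0 < ((X M).filter fun w => p <+: w).card :=
        Finset.card_pos.mpr ⟨p, Finset.mem_filter.mpr ⟨h, List.prefix_rfl⟩⟩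
      have : (1 : ℚ) ≤ ((X M).filter fun w => p <+: w).card := by exact_mod_cast this
      linarith
    · simp
  | succ n ih =>
    intro p
    have hdisj : Disjoint ((X M).filter fun w => p ++ [false] <+: w)
        ((X M).filter fun w => p ++ [true] <+: w) := by
      rw [Finset.disjoint_filter]
      intro w _ h1 h2
      have h := List.prefix_of_prefix_length_le h1 h2 (by simp)
      simp at h
    have hsub : ((X M).filter fun w => p ++ [false] <+: w) ∪
        ((X M).filter fun w => p ++ [true] <+: w) ⊆ (X M).filter fun w => p <+: w := by
      intro w hw
      simp only [Finset.mem_union, Finset.mem_filter] at hw ⊢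
      rcases hw with ⟨h1, h2⟩ | ⟨h1, h2⟩ <;> exact ⟨h1, (List.prefix_append _ _).trans h2⟩
    have hcard := Finset.card_le_card hsub
    rw [Finset.card_union_of_disjoint hdisj] at hcard
    have hcard' : ((((X M).filter fun w => p ++ [false] <+: w).card : ℕ) : ℚ) +
        (((X M).filter fun w => p ++ [true] <+: w).card : ℕ) ≤
        (((X M).filter fun w => p <+: w).card : ℕ) := by exact_mod_cast hcard
    have h1 := ih (p ++ [false])
    have h2 := ih (p ++ [true])
    rw [totalWeight, pow_succ]
    linarith

variable {l}

/-- The state of the gambler in the mode `M` after reading the part `p` of a word. -/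
def state (hl : 0 < l) (M : Bool) (p : List Bool) : Bool × {p : List Bool // p.length < l} :=
  if h : p.length < l then (M, ⟨p, h⟩) else (nextMode X M p, ⟨[], hl⟩)

/-- A gambler that reads words of length `l`, bets in the mode `M` preferably on words of `X M`, and
toggles its mode after any other word. -/
def gambler (hl : 0 < l) (hη : 0 < η) : FSG Bool where
  Q := Bool × {p : List Bool // p.length < l}
  finQ := by
    have : Finite {p : List Bool // p.length < l} := (List.finite_length_lt Bool l).to_subtype
    infer_instance
  δ q a := some (state X hl q.1 (q.2.1 ++ [a]))
  β q :=
    -- The conditional probability of the next bit when a word of length `l` is drawn with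
    -- probability proportional to its weight.
    { prob := fun a => totalWeight X η q.1 (l - q.2.1.length - 1) (q.2.1 ++ [a]) /
        totalWeight X η q.1 (l - q.2.1.length) q.2.1
      nonneg := fun a => (div_pos (totalWeight_pos X hη _ _ _) (totalWeight_pos X hη _ _ _)).le
      sum_eq_one := by
        obtain ⟨n, hn⟩ : ∃ n, l - q.2.1.length = n + 1 :=
          ⟨l - q.2.1.length - 1, by have := q.2.2; omega⟩
        rw [← Finset.sum_div, hn, div_eq_one_iff_eq (totalWeight_pos X hη _ _ _).ne',
          Fintype.sum_bool, totalWeight, add_comm, Nat.add_sub_cancel] }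
  q₀ := (true, ⟨[], hl⟩)

variable (hl : 0 < l) (hη : 0 < η)

theorem state_nil (M : Bool) : state X hl M [] = (M, ⟨[], hl⟩) := dif_pos hl

theorem state_word (M : Bool) {w : List Bool} (hw : w.length = l) :
    state X hl M w = state X hl (nextMode X M w) [] := by
  rw [state_nil, state, dif_neg (by omega)]

/-- The state `state X hl M p` as a state of the gambler. -/
def start (M : Bool) (p : List Bool) : Option (gambler X hl hη).Q := some (state X hl M p)

theorem step_start (M : Bool) {p : List Bool} (hp : p.length < l) (a : Bool) :
    (gambler X hl hη).step (start X hl hη M p) a = start X hl hη M (p ++ [a]) := by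
  have hs : state X hl M p = (M, ⟨p, hp⟩) := dif_pos hp
  change some (state X hl (state X hl M p).1 ((state X hl M p).2.1 ++ [a])) = _
  rw [hs]
  rfl

theorem run_state (M : Bool) (v : List Bool) : ∀ p, p.length + v.length = l →
    (gambler X hl hη).run (start X hl hη M p) v = start X hl hη M (p ++ v) := by
  induction v with
  | nil => intro p _; rw [List.append_nil]; rfl
  | cons a v ih =>
    intro p hp
    rw [List.length_cons] at hp
    have h := ih (p ++ [a]) (by simp; omega)
    rw [List.append_assoc, List.singleton_append] at h
    rw [← h, ← step_start X hl hη M (by omega)]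
    rfl

/-- The bets are ratios of successive total weights, so their product telescopes. -/
theorem galeFrom_state (s : ℝ) (M : Bool) (v : List Bool) : ∀ p, p.length + v.length = l →
    (gambler X hl hη).galeFrom s (start X hl hη M p) v =
      ((Fintype.card Bool : ℝ) ^ s) ^ v.length * weight X η M (p ++ v) /
        totalWeight X η M v.length p := by
  induction v with
  | nil =>
    intro p _
    have : ((weight X η M p : ℚ) : ℝ) ≠ 0 := Rat.cast_ne_zero.mpr (weight_pos X hη M p).ne'
    simp [FSG.galeFrom, totalWeight, div_self this]
  | cons a v ih =>
    intro p hp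
    rw [List.length_cons] at hp
    have h := ih (p ++ [a]) (by simp; omega)
    rw [List.append_assoc, List.singleton_append] at h
    have hs : state X hl M p = (M, ⟨p, by omega⟩) := dif_pos (by omega)
    have hbet : (gambler X hl hη).bet (start X hl hη M p) a =
        (totalWeight X η M v.length (p ++ [a]) : ℝ) / totalWeight X η M (v.length + 1) p := by
      change (((totalWeight X η (state X hl M p).1 (l - (state X hl M p).2.1.length - 1)
        ((state X hl M p).2.1 ++ [a]) / totalWeight X η (state X hl M p).1
        (l - (state X hl M p).2.1.length) (state X hl M p).2.1 : ℚ)) : ℝ) = _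
      rw [hs]
      dsimp only
      rw [show l - p.length - 1 = v.length by omega, show l - p.length = v.length + 1 by omega]
      push_cast
      rfl
    have hne : (totalWeight X η M v.length (p ++ [a]) : ℝ) ≠ 0 :=
      Rat.cast_ne_zero.mpr (totalWeight_pos X hη _ _ _).ne'
    have hne' : (totalWeight X η M (v.length + 1) p : ℝ) ≠ 0 :=
      Rat.cast_ne_zero.mpr (totalWeight_pos X hη _ _ _).ne'
    rw [FSG.galeFrom, hbet, step_start X hl hη M (by omega), h, List.length_cons, pow_succ']
    field_simp

/-- From the start of a word in the mode `M`, reading `u` ends at the start of a word in the mode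
`M'` and multiplies the `s`-gale by at least `C`. -/
def Gains (s : ℝ) (M M' : Bool) (u : List Bool) (C : ℝ) : Prop :=
  (gambler X hl hη).run (start X hl hη M []) u = start X hl hη M' [] ∧
    C ≤ (gambler X hl hη).galeFrom s (start X hl hη M []) u

theorem Gains.append {s : ℝ} {M M' M'' : Bool} {u v : List Bool} {C D : ℝ}
    (hu : Gains X hl hη s M M' u C) (hv : Gains X hl hη s M' M'' v D) (hD : 0 ≤ D) :
    Gains X hl hη s M M'' (u ++ v) (C * D) := by
  refine ⟨?_, ?_⟩
  · rw [← hv.1, ← hu.1]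
    exact List.foldl_append
  · rw [FSG.galeFrom_append, hu.1]
    exact mul_le_mul hu.2 hv.2 hD (FSG.galeFrom_nonneg _ _ _ _)

theorem gains_nil (s : ℝ) (M : Bool) : Gains X hl hη s M M [] 1 := ⟨rfl, le_rfl⟩

theorem gains_word {s θ : ℝ} {N : ℕ} (hX : ∀ M, (X M).card ≤ N)
    (hθ : θ = ((Fintype.card Bool : ℝ) ^ s) ^ l / ((N : ℝ) + (η : ℝ) * 2 ^ l))
    (M : Bool) {w : List Bool} (hw : w.length = l) :
    Gains X hl hη s M (nextMode X M w) w (θ * weight X η M w) := by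
  have hη' : (0 : ℝ) < η := Rat.cast_pos.mpr hη
  refine ⟨?_, ?_⟩
  · rw [run_state X hl hη M w [] (by simpa using hw), List.nil_append, start, state_word X hl M hw]
    rfl
  · rw [galeFrom_state X hl hη s M w [] (by simpa using hw), hw, hθ, List.nil_append,
      div_mul_eq_mul_div]
    have hT : (totalWeight X η M l [] : ℝ) ≤ (N : ℝ) + (η : ℝ) * 2 ^ l := by
      have h := totalWeight_le X hη M l []
      have h2 : (((X M).filter fun w => [] <+: w).card : ℚ) ≤ N := by
        exact_mod_cast (Finset.card_filter_le _ _).trans (hX M)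
      have h3 : totalWeight X η M l [] ≤ (N : ℚ) + η * 2 ^ l := by linarith
      exact_mod_cast h3
    refine div_le_div_of_nonneg_left ?_ (Rat.cast_pos.mpr (totalWeight_pos X hη M l [])) hT
    exact mul_nonneg (pow_nonneg (FSG.card_rpow_nonneg Bool s) _)
      (Rat.cast_nonneg.mpr (weight_pos X hη M w).le)

theorem gains_flatten_of_mode {s θ : ℝ} {N : ℕ} (hX : ∀ M, (X M).card ≤ N)
    (hθ : θ = ((Fintype.card Bool : ℝ) ^ s) ^ l / ((N : ℝ) + (η : ℝ) * 2 ^ l)) (hθ1 : 1 ≤ θ)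
    (M : Bool) (ws : List (List Bool))
    (hws : ∀ w ∈ ws, w ∈ X M)
    (hlen : ∀ w ∈ ws, w.length = l) :
    Gains X hl hη s M M ws.flatten (θ ^ ws.length) := by
  induction ws with
  | nil => exact gains_nil X hl hη s M
  | cons w ws ih =>
    have hw : w ∈ X M := hws w (by simp)
    have h := gains_word X hl hη hX hθ M (hlen w (by simp))
    rw [nextMode, if_pos hw, weight, if_pos hw, Rat.cast_one, mul_one] at h
    rw [List.flatten_cons, List.length_cons, pow_succ']
    exact h.append X hl hη (ih (fun v hv => hws v (by simp [hv])) fun v hv => hlen v (by simp [hv]))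
      (by positivity)

/-- A wrong mode does no harm until a word falls outside its set. That word costs one factor `η` and
switches to the right mode, which then persists. -/
theorem gains_flatten {s θ : ℝ} {N : ℕ} (hX : ∀ M, (X M).card ≤ N)
    (hθ : θ = ((Fintype.card Bool : ℝ) ^ s) ^ l / ((N : ℝ) + (η : ℝ) * 2 ^ l)) (hθ1 : 1 ≤ θ)
    (hη1 : η ≤ 1) (M M' : Bool) (ws : List (List Bool)) (hws : ∀ w ∈ ws, w ∈ X M')
    (hlen : ∀ w ∈ ws, w.length = l) :
    ∃ M'', Gains X hl hη s M M'' ws.flatten (θ ^ ws.length * η) := by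
  have hη1' : (η : ℝ) ≤ 1 := by exact_mod_cast hη1
  have hη0' : (0 : ℝ) < η := Rat.cast_pos.mpr hη
  rcases eq_or_ne M M' with rfl | hM
  · refine ⟨M, ?_⟩
    obtain ⟨h1, h2⟩ := gains_flatten_of_mode X hl hη hX hθ hθ1 M ws hws hlen
    exact ⟨h1, (mul_le_of_le_one_right (by positivity) hη1').trans h2⟩
  · have hM' : M' = !M := by cases M <;> cases M' <;> simp_all
    induction ws with
    | nil => exact ⟨M, rfl, by simpa [FSG.galeFrom] using hη1'⟩
    | cons w ws ih =>
      have hws' : ∀ v ∈ ws, v ∈ X M' := fun v hv => hws v (by simp [hv])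
      have hlen' : ∀ v ∈ ws, v.length = l := fun v hv => hlen v (by simp [hv])
      have h := gains_word X hl hη hX hθ M (hlen w (by simp))
      rw [List.flatten_cons, List.length_cons, pow_succ']
      by_cases hw : w ∈ X M
      · rw [nextMode, if_pos hw, weight, if_pos hw, Rat.cast_one, mul_one] at h
        obtain ⟨M'', h'⟩ := ih hws' hlen'
        refine ⟨M'', ?_⟩
        rw [mul_assoc]
        exact h.append X hl hη h' (by positivity)
      · rw [nextMode, if_neg hw, weight, if_neg hw, ← hM'] at h
        refine ⟨M', ?_⟩
        rw [mul_right_comm]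
        exact h.append X hl hη (gains_flatten_of_mode X hl hη hX hθ hθ1 M' ws hws' hlen')
          (by positivity)

/-- One factor `η` each for `ws`, `c` and `ws'`. Whether `c` toggles the mode is immaterial, because
each half corrects the mode by itself. -/
theorem gains_block {s θ : ℝ} {N : ℕ} (hX : ∀ M, (X M).card ≤ N)
    (hθ : θ = ((Fintype.card Bool : ℝ) ^ s) ^ l / ((N : ℝ) + (η : ℝ) * 2 ^ l)) (hθ1 : 1 ≤ θ)
    (hη1 : η ≤ 1) (M : Bool) (ws ws' : List (List Bool)) (c : List Bool) (hc : c.length = l)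
    (hws : ∀ w ∈ ws, w ∈ X true) (hws' : ∀ w ∈ ws', w ∈ X false)
    (hlen : ∀ M, ∀ w ∈ X M, w.length = l) :
    ∃ M'', Gains X hl hη s M M'' (ws.flatten ++ c ++ ws'.flatten) (θ ^ ws.length * η ^ 3) := by
  have hη0' : (0 : ℝ) < η := Rat.cast_pos.mpr hη
  obtain ⟨M₁, h1⟩ := gains_flatten X hl hη hX hθ hθ1 hη1 M true ws hws
    fun w hw => hlen _ w (hws w hw)
  have h2 := gains_word X hl hη hX hθ M₁ hc
  obtain ⟨M₃, h3⟩ := gains_flatten X hl hη hX hθ hθ1 hη1 (nextMode X M₁ c) false ws' hws'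
    fun w hw => hlen _ w (hws' w hw)
  have hwt : (η : ℝ) ≤ weight X η M₁ c := Rat.cast_le.mpr (le_weight X hη1 M₁ c)
  have hwt0 : (0 : ℝ) < weight X η M₁ c := hη0'.trans_le hwt
  have h := (h1.append X hl hη h2 (by positivity)).append X hl hη h3 (by positivity)
  refine ⟨M₃, h.1, le_trans ?_ h.2⟩
  calc θ ^ ws.length * (η : ℝ) ^ 3 = θ ^ ws.length * η * (1 * η) * (1 * η) := by ring
    _ ≤ _ := by
      gcongr
      exact one_le_pow₀ hθ1

end ToggleGambler

theorem FSG.succeeds_of_forall {α : Type} [Fintype α] (G : FSG α) (s : ℝ) (S : ℕ → α)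
    (h : ∀ (C : ℝ) (m : ℕ), ∃ n, m ≤ n ∧ C ≤ G.gale s (seqPrefix S n)) : G.Succeeds s S := by
  rw [FSG.Succeeds, EReal.eq_top_iff_forall_lt]
  intro C
  refine (EReal.coe_lt_coe_iff.mpr (lt_add_one C)).trans_le ?_
  refine le_limsup_of_frequently_le (frequently_atTop.mpr fun m => ?_) (by isBoundedDefault)
  obtain ⟨n, hn, hC⟩ := h (C + 1) m
  exact ⟨n, hn, EReal.coe_le_coe_iff.mpr hC⟩

open ToggleGambler in
/-- A concatenation of blocks `u c v`, where `u` is made of words from `X true` and `v` of words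
from `X false`, has `s`-successful gamblers whenever `2 ^ (s * l)` exceeds the cardinalities of
`X true` and `X false`. -/
theorem exists_succeeds_of_blocks {l N : ℕ} (hl : 0 < l) (X : Bool → Finset (List Bool))
    (hX : ∀ M, (X M).card ≤ N) (hlen : ∀ M, ∀ w ∈ X M, w.length = l) {s : ℝ}
    (hs : (N : ℝ) < ((Fintype.card Bool : ℝ) ^ s) ^ l) (b : ℕ → List Bool) (c : List Bool)
    (hc : c.length = l)
    (hb : ∀ k, ∃ ws ws' : List (List Bool), k ≤ ws.length ∧ (∀ w ∈ ws, w ∈ X true) ∧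
      (∀ w ∈ ws', w ∈ X false) ∧ b k = ws.flatten ++ c ++ ws'.flatten) :
    ∃ G : FSG Bool, G.Succeeds s (infConcat b) := by
  set R : ℝ := ((Fintype.card Bool : ℝ) ^ s) ^ l with hR
  -- Bets must be rational, hence a rational `η`; `η < (R - N) / 2 ^ l` keeps the total weight of
  -- all words below `R`, so that `θ > 1`.
  obtain ⟨η, h0, h1⟩ := exists_rat_btwn
    (show (0 : ℝ) < min 1 ((R - N) / 2 ^ l) from
      lt_min one_pos (div_pos (sub_pos.mpr hs) (by positivity)))
  have hη : 0 < η := by exact_mod_cast h0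
  have hη1 : η ≤ 1 := by exact_mod_cast (h1.trans_le (min_le_left _ _)).le
  have hT : (N : ℝ) + η * 2 ^ l < R := by
    have := (lt_div_iff₀ (by positivity)).mp (h1.trans_le (min_le_right _ _))
    linarith
  have hT0 : 0 < (N : ℝ) + η * 2 ^ l := by positivity
  obtain ⟨θ, hθ⟩ : ∃ θ, θ = R / ((N : ℝ) + η * 2 ^ l) := ⟨_, rfl⟩
  have hθ1 : 1 < θ := by rw [hθ]; exact (one_lt_div hT0).mpr hT
  have hbne : ∀ k, b k ≠ [] := by
    intro k hk
    obtain ⟨ws, ws', -, -, -, h⟩ := hb k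
    rw [hk] at h
    have := congrArg List.length h
    simp only [List.length_append, List.length_nil] at this
    omega
  have hblock : ∀ k M, ∃ M', Gains X hl hη s M M' (b k) (θ ^ k * η ^ 3) := by
    intro k M
    obtain ⟨ws, ws', hk, hws, hws', h⟩ := hb k
    obtain ⟨M', h1, h2⟩ := gains_block X hl hη hX hθ hθ1.le hη1 M ws ws' c hc hws hws' hlen
    rw [h]
    refine ⟨M', h1, le_trans ?_ h2⟩
    gcongr
    exact hθ1.le
  have hconcat : ∀ m, ∃ M C, 0 < C ∧ Gains X hl hη s true M (concatFirst b m) C := by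
    intro m
    induction m with
    | zero => exact ⟨true, 1, one_pos, gains_nil X hl hη s true⟩
    | succ m ih =>
      obtain ⟨M, C, hC, h⟩ := ih
      obtain ⟨M', h'⟩ := hblock m M
      rw [concatFirst_succ]
      exact ⟨M', _, by positivity, h.append X hl hη h' (by positivity)⟩
  -- From block `m₀` on, `θ ^ m * η ^ 3 ≥ 2`, so each block at least doubles the capital.
  obtain ⟨m₀, hm₀⟩ := eventually_atTop.mp
    ((tendsto_pow_atTop_atTop_of_one_lt hθ1).eventually_ge_atTop (2 / (η : ℝ) ^ 3))
  obtain ⟨M₀, C, hC, hgain⟩ := hconcat m₀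
  have hdouble : ∀ j, ∃ M, Gains X hl hη s true M (concatFirst b (m₀ + j)) (C * 2 ^ j) := by
    intro j
    induction j with
    | zero => exact ⟨M₀, by simpa using hgain⟩
    | succ j ih =>
      obtain ⟨M, h⟩ := ih
      obtain ⟨M', h'⟩ := hblock (m₀ + j) M
      rw [← add_assoc, concatFirst_succ, pow_succ, ← mul_assoc]
      refine ⟨M', h.append X hl hη ⟨h'.1, le_trans ?_ h'.2⟩ zero_le_two⟩
      exact (div_le_iff₀ (by positivity)).mp (hm₀ (m₀ + j) (by omega))
  refine ⟨gambler X hl hη, FSG.succeeds_of_forall _ s _ fun D m => ?_⟩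
  obtain ⟨j₀, hj₀⟩ := pow_unbounded_of_one_lt (D / C) (one_lt_two (α := ℝ))
  obtain ⟨M, -, h⟩ := hdouble (max m j₀)
  refine ⟨(concatFirst b (m₀ + max m j₀)).length, ?_, ?_⟩
  · exact (le_trans (le_max_left m j₀) (Nat.le_add_left _ _)).trans
      (le_length_concatFirst b hbne _)
  · rw [seqPrefix_infConcat b hbne, FSG.gale,
      show some (gambler X hl hη).q₀ = start X hl hη true [] by rw [start, state_nil]; rfl]
    refine le_trans ?_ h
    rw [mul_comm]
    refine (div_le_iff₀ hC).mp (hj₀.le.trans ?_)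
    exact pow_le_pow_right₀ one_le_two (le_max_right _ _)

end PDDim

/-! ### The blocks of `C'` as listings, and the conclusion -/

namespace PDDim

theorem IsListing.reverse {α : Type} {m L : ℕ} {u : List α} (hu : IsListing m L u) :
    IsListing m L u.reverse := by
  obtain ⟨ws, hnd, hm, hL, rfl⟩ := hu
  refine ⟨(ws.map List.reverse).reverse, ?_, by simpa using hm, ?_, List.reverse_flatten⟩
  · exact List.nodup_reverse.mpr (hnd.map List.reverse_injective)
  · intro w hw
    obtain ⟨v, hv, rfl⟩ := List.mem_map.mp (List.mem_reverse.mp hw)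
    simpa using hL v hv

theorem length_flatten_of_forall_length {α : Type} {l : ℕ} {w : List (List α)}
    (hw : ∀ a ∈ w, a.length = l) : w.flatten.length = w.length * l := by
  rw [List.length_flatten, List.map_eq_replicate_iff.mpr hw, List.sum_replicate, smul_eq_mul]

/-- Characters of a common length `l` can be recovered from the flattened string, so distinct words
over `A` stay distinct as bit strings. -/
theorem isListing_flatten {α : Type} {i l : ℕ} (V : List (List (List α))) (hnd : V.Nodup)
    (hV : ∀ w ∈ V, w.length = i ∧ ∀ a ∈ w, a.length = l) :
    IsListing V.length (i * l) V.flatten.flatten := by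
  refine ⟨V.map List.flatten, hnd.map_on ?_, by simp, ?_, List.flatten_flatten⟩
  · intro v hv w hw h
    refine List.eq_iff_flatten_eq.mpr ⟨h, ?_⟩
    rw [List.map_eq_replicate_iff.mpr (hV v hv).2, List.map_eq_replicate_iff.mpr (hV w hw).2,
      (hV v hv).1, (hV w hw).1]
  · intro w hw
    obtain ⟨v, hv, rfl⟩ := List.mem_map.mp hw
    rw [length_flatten_of_forall_length (hV v hv).2, (hV v hv).1]

theorem card_wordsOver (A : Finset (List Bool)) (i : ℕ) : (wordsOver A i).card = A.card ^ i := by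
  rw [wordsOver, Finset.card_image_of_injective _ List.ofFn_injective, Fintype.card_piFinset]
  simp

theorem flatten_flatten_replicate {α : Type} (i : ℕ) (u : List (List α)) :
    (List.replicate i u).flatten.flatten = (List.replicate i u.flatten).flatten := by
  rw [List.flatten_flatten, List.map_replicate]

theorem reverse_flatten_replicate {α : Type} (i : ℕ) (u : List α) :
    (List.replicate i u).flatten.reverse = (List.replicate i u.reverse).flatten := by
  rw [List.reverse_flatten, List.map_replicate, List.reverse_replicate]

theorem mem_of_mem_alphaPow {A : Finset (List Bool)} {i : ℕ} {a : List Bool}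
    (ha : a ∈ alphaPow A i) : a ∈ A := by
  rw [alphaPow, List.mem_flatten] at ha
  obtain ⟨u, hu, ha⟩ := ha
  rw [List.eq_of_mem_replicate hu, alphaStr, List.mem_flatten] at ha
  obtain ⟨w, hw, ha⟩ := ha
  exact ((mem_wordsOver A i w).mp ((Finset.mem_sort _).mp hw)).2 a ha

theorem le_length_alphaPow {A : Finset (List Bool)} (hA : A.Nonempty) {i : ℕ} (hi : 0 < i) :
    i ≤ (alphaPow A i).length := by
  obtain ⟨a, ha⟩ := hA
  have hpos : 0 < (alphaStr A i).length := by
    refine List.length_pos_of_mem (a := a) (List.mem_flatten.mpr ⟨List.replicate i a, ?_, ?_⟩)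
    · rw [Finset.mem_sort, mem_wordsOver]
      exact ⟨List.length_replicate, fun b hb => List.eq_of_mem_replicate hb ▸ ha⟩
    · exact List.mem_replicate.mpr ⟨hi.ne', rfl⟩
  rw [alphaPow, List.length_flatten, List.map_replicate, List.sum_replicate, smul_eq_mul]
  exact Nat.le_mul_of_pos_right i hpos

theorem isListing_alphaStr {A : Finset (List Bool)} {l : ℕ}
    (hA : ∀ a ∈ A, a.length = l) (i : ℕ) :
    IsListing (A.card ^ i) (i * l) (alphaStr A i).flatten := by
  have h := isListing_flatten (i := i) (l := l) ((wordsOver A i).sort (· ≤ ·))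
    (Finset.sort_nodup _ _) fun w hw => by
      obtain ⟨h1, h2⟩ := (mem_wordsOver A i w).mp ((Finset.mem_sort _).mp hw)
      exact ⟨h1, fun a ha => hA a (h2 a ha)⟩
  rwa [Finset.length_sort, card_wordsOver] at h

/-- Reversing characters reverses each word and the order of the words; reversal being injective,
the words stay distinct. -/
theorem isListing_alphaStr_reverse {A : Finset (List Bool)} {l : ℕ}
    (hA : ∀ a ∈ A, a.length = l) (i : ℕ) :
    IsListing (A.card ^ i) (i * l) (alphaStr A i).reverse.flatten := by
  have h := isListing_flatten (i := i) (l := l)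
    (((wordsOver A i).sort (· ≤ ·)).map List.reverse).reverse
    (List.nodup_reverse.mpr ((Finset.sort_nodup _ _).map List.reverse_injective)) fun w hw => by
      obtain ⟨v, hv, rfl⟩ := List.mem_map.mp (List.mem_reverse.mp hw)
      obtain ⟨h1, h2⟩ := (mem_wordsOver A i v).mp ((Finset.mem_sort _).mp hv)
      exact ⟨by simpa using h1, fun a ha => hA a (h2 a (List.mem_reverse.mp ha))⟩
  rw [List.length_reverse, List.length_map, Finset.length_sort, card_wordsOver] at h
  rwa [alphaStr, List.reverse_flatten]

theorem two_rpow_pow_eq (s : ℝ) (l : ℕ) : ((Fintype.card Bool : ℝ) ^ s) ^ l = (2 : ℝ) ^ (s * l) := by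
  rw [Fintype.card_bool, Real.rpow_mul_natCast (by norm_num), Nat.cast_ofNat]

/-- A sequence has finite-state dimension `d` if it has `s`-successful gamblers for all `s > d` but
for no nonnegative `s < d`. -/
theorem dimFS_eq {α : Type} [Fintype α] {S : ℕ → α} {d : ℝ} (hd : 0 ≤ d)
    (hlower : ∀ s, 0 ≤ s → s < d → ∀ G : FSG α, ¬ G.Succeeds s S)
    (hupper : ∀ s, d < s → ∃ G : FSG α, G.Succeeds s S) : dimFS S = d := by
  refine le_antisymm ?_ ?_
  · refine EReal.le_of_forall_lt_iff_le.mp fun s hs => ?_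
    have hs' : d < s := EReal.coe_lt_coe_iff.mp hs
    exact sInf_le ⟨s, ⟨hd.trans hs'.le, hupper s hs'⟩, rfl⟩
  · refine le_sInf ?_
    rintro _ ⟨s, ⟨hs, G, hG⟩, rfl⟩
    by_contra hcon
    exact hlower s hs (EReal.coe_lt_coe_iff.mp (not_le.mp hcon)) G hG

theorem champMarked_block (l : ℕ) (A : Finset (List Bool)) (i : ℕ) :
    (alphaPow A i ++ [marker l] ++ (alphaPow A i).reverse).flatten =
      (alphaPow A i).flatten ++ marker l ++ (alphaPow A i).reverse.flatten := by
  simp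

end PDDim

theorem mainTheorem3 (d : ℚ) (hd0 : 0 < d) (hd1 : d < 1)
    (dn l : ℕ) (hdn : 0 < dn) (hl : 0 < l) (hd : d = (dn : ℚ) / (l : ℚ))
    (A : Finset (List Bool)) (hA : ∀ w ∈ A, w.length = l ∧ w ≠ PDDim.marker l)
    (hcard : Real.logb 2 (A.card : ℝ) = (dn : ℝ)) :
    PDDim.dimFS (PDDim.champMarked l A) = ((d : ℝ) : EReal) ∧
      PDDim.dimFS (PDDim.champMarkedBitRev l A) = ((d : ℝ) : EReal) := by
  have hdn' : (0 : ℝ) < dn := by exact_mod_cast hdn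
  have hl' : (0 : ℝ) < l := by exact_mod_cast hl
  have hne : A.Nonempty := by
    rw [Finset.nonempty_iff_ne_empty]
    rintro rfl
    rw [Finset.card_empty, Nat.cast_zero, Real.logb_zero] at hcard
    exact hdn'.ne hcard
  have hApos : (0 : ℝ) < A.card := by exact_mod_cast hne.card_pos
  have hAcard : (A.card : ℝ) = (2 : ℝ) ^ (dn : ℝ) :=
    ((Real.logb_eq_iff_rpow_eq two_pos (by norm_num) hApos).mp hcard).symm
  have hA1 : 1 < A.card := by
    have : (1 : ℝ) < A.card := by rw [hAcard]; exact Real.one_lt_rpow one_lt_two hdn'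
    exact_mod_cast this
  have hdR : (d : ℝ) = dn / l := by rw [hd]; push_cast; rfl
  have hd0' : (0 : ℝ) ≤ d := by exact_mod_cast hd0.le
  have hlow : ∀ s : ℝ, s < d → ((Fintype.card Bool : ℝ) ^ s) ^ l < A.card := fun s hs => by
    rw [PDDim.two_rpow_pow_eq, hAcard]
    exact Real.rpow_lt_rpow_of_exponent_lt one_lt_two ((lt_div_iff₀ hl').mp (hdR ▸ hs))
  have hupp : ∀ s : ℝ, d < s → (A.card : ℝ) < ((Fintype.card Bool : ℝ) ^ s) ^ l := fun s hs => by
    rw [PDDim.two_rpow_pow_eq, hAcard]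
    exact Real.rpow_lt_rpow_of_exponent_lt one_lt_two ((div_lt_iff₀ hl').mp (hdR ▸ hs))
  have hlen : ∀ a ∈ A, a.length = l := fun a ha => (hA a ha).1
  have hmarker : (PDDim.marker l).length = l := List.length_replicate
  have hlong : ∀ k, k ≤ (PDDim.alphaPow A (k + 1)).length := fun k =>
    (Nat.le_succ k).trans (PDDim.le_length_alphaPow hne k.succ_pos)
  constructor
  · refine PDDim.dimFS_eq hd0' (fun s hs0 hs G => ?_) (fun s hs => ?_)
    · refine PDDim.not_succeeds_of_listings G hs0 hA1 hl (hlow s hs) _ _ hmarker fun k =>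
        ⟨_, _, PDDim.isListing_alphaStr hlen (k + 1),
          PDDim.isListing_alphaStr_reverse hlen (k + 1), ?_⟩
      rw [PDDim.champMarked_block, PDDim.alphaPow, PDDim.reverse_flatten_replicate,
        PDDim.flatten_flatten_replicate, PDDim.flatten_flatten_replicate]
    · refine PDDim.exists_succeeds_of_blocks hl (fun _ => A) (fun _ => le_rfl) (fun _ => hlen)
        (hupp s hs) _ _ hmarker fun k =>
        ⟨_, _, hlong k, fun w hw => PDDim.mem_of_mem_alphaPow hw,
          fun w hw => PDDim.mem_of_mem_alphaPow (List.mem_reverse.mp hw),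
          PDDim.champMarked_block l A (k + 1)⟩
  · refine PDDim.dimFS_eq hd0' (fun s hs0 hs G => ?_) (fun s hs => ?_)
    · refine PDDim.not_succeeds_of_listings G hs0 hA1 hl (hlow s hs) _ _ hmarker fun k =>
        ⟨_, _, PDDim.isListing_alphaStr hlen (k + 1),
          (PDDim.isListing_alphaStr hlen (k + 1)).reverse, ?_⟩
      rw [PDDim.alphaPow, PDDim.flatten_flatten_replicate, PDDim.reverse_flatten_replicate]
    · refine PDDim.exists_succeeds_of_blocks hl
        -- Bit reversal turns characters of `A` into reversed ones. Two modes keep each set at size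
        -- at most `|A|`, whereas betting on the union could cost a factor of two.
        (fun M => if M then A else A.image List.reverse) (fun M => ?_) (fun M w hw => ?_)
        (hupp s hs) _ _ hmarker fun k =>
        ⟨PDDim.alphaPow A (k + 1), ((PDDim.alphaPow A (k + 1)).map List.reverse).reverse, hlong k,
          fun w hw => PDDim.mem_of_mem_alphaPow hw, fun w hw => ?_, by rw [List.reverse_flatten]⟩
      · cases M
        · exact Finset.card_image_le
        · exact le_rfl
      · cases M
        · obtain ⟨v, hv, rfl⟩ := Finset.mem_image.mp hw
          rw [List.length_reverse, hlen v hv]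
        · exact hlen w hw
      · obtain ⟨v, hv, rfl⟩ := List.mem_map.mp (List.mem_reverse.mp hw)
        exact Finset.mem_image_of_mem _ (PDDim.mem_of_mem_alphaPow hv)
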